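/- Let $X$ be a real Hilbert space and let $A,B\colon X\rightrightarrows X$ be maximally monotone set-valued operators. For a maximally monotone operator $C$ write $\operatorname{dom}C=\{x : Cx\neq\varnothing\}$, $\operatorname{ran}C=\bigcup_{x}Cx$, let $C^{-1}$ be the set-valued inverse, let $J_C=(\mathrm{Id}+C)^{-1}$ be the resolvent (a single-valued map defined on all of $X$), and put $R_C=2J_C-\mathrm{Id}$. Let $T=\mathrm{Id}-J_A+J_BR_A$ be the Douglas--Rachford operator, put $$D=\operatorname{dom}A-\operatorname{dom}B,\qquad R=\operatorname{ran}A+\operatorname{ran}B,$$ and let $v_D=P_{\overline D}(0)$ and $v_R=P_{\overline R}(0)$ be the elements of minimal norm of the closures $\overline D$ and $\overline R$ (which are nonempty, closed and convex). Assume that $$\overline{\operatorname{ran}}(\mathrm{Id}-T)=\overline{D\cap R}=\overline D\cap\overline R .$$ Then for every $x\in X$, as $n\to\infty$, in norm: (i) $\frac1n J_A T^n x\to -v_R$; (ii) $\frac1n J_{A^{-1}}T^n x\to -v_D$. -/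

import Mathlib

open Filter Topology

namespace DouglasRachford

variable {X : Type*} [NormedAddCommGroup X] [InnerProductSpace ℝ X]

/-- The domain `{x | A x ≠ ∅}` of a set-valued operator `A : X ⇉ X`. -/
def dom (A : X → Set X) : Set X := {x | (A x).Nonempty}

/-- The range `⋃ x, A x` of a set-valued operator. -/
def ran (A : X → Set X) : Set X := ⋃ x, A x

/-- The set-valued inverse: `x ∈ A⁻¹ u` if and only if `u ∈ A x`. -/
def inv (A : X → Set X) : X → Set X := fun u => {x | u ∈ A x}

/-- The set-valued operator `Id + A`. -/
def idAdd (A : X → Set X) : X → Set X := fun x => {y | ∃ u ∈ A x, y = x + u}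

/-- Monotonicity of a set-valued operator. -/
def IsMonotone (A : X → Set X) : Prop :=
  ∀ x y : X, ∀ u ∈ A x, ∀ v ∈ A y, 0 ≤ inner ℝ (x - y) (u - v)

/-- Maximal monotonicity: `A` is monotone and its graph is not properly contained in the graph
of a monotone operator. -/
def IsMaximallyMonotone (A : X → Set X) : Prop :=
  IsMonotone A ∧ ∀ A' : X → Set X, IsMonotone A' → (∀ x, A x ⊆ A' x) → A' = A

/-- The resolvent `J_A = (Id + A)⁻¹` as a map `X → X`: the point of `(Id + A)⁻¹ x`.
(For maximally monotone `A` on a Hilbert space this set is a singleton for every `x`.) -/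
noncomputable def resolvent (A : X → Set X) (x : X) : X :=
  Classical.epsilon fun p => p ∈ inv (idAdd A) x

/-- The reflected resolvent `R_A = 2 J_A - Id`. -/
noncomputable def reflected (A : X → Set X) (x : X) : X := (2 : ℝ) • resolvent A x - x

/-- The Douglas–Rachford operator `T = Id - J_A + J_B R_A`. -/
noncomputable def drOperator (A B : X → Set X) (x : X) : X :=
  x - resolvent A x + resolvent B (reflected A x)

/-- The projection `P_C x`: the point of `C` nearest to `x`.
(It exists and is unique when `C` is a nonempty closed convex subset of a Hilbert space.) -/
noncomputable def proj (C : Set X) (x : X) : X :=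
  Classical.epsilon fun p => p ∈ C ∧ ∀ c ∈ C, ‖x - p‖ ≤ ‖x - c‖

/-- The set `D = dom A - dom B` of differences. -/
def setD (A B : X → Set X) : Set X := {z | ∃ a ∈ dom A, ∃ b ∈ dom B, z = a - b}

/-- The set `R = ran A + ran B` of sums. -/
def setR (A B : X → Set X) : Set X := {z | ∃ a ∈ ran A, ∃ b ∈ ran B, z = a + b}

/-- `v_D`, the projection of `0` onto the closure of `dom A - dom B`. -/
noncomputable def vD (A B : X → Set X) : X := proj (closure (setD A B)) 0

/-- `v_R`, the projection of `0` onto the closure of `ran A + ran B`. -/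
noncomputable def vR (A B : X → Set X) : X := proj (closure (setR A B)) 0

end DouglasRachford

/-! Write `a n` for `J_A (T^n x)` and `u n` for `T^n x - a n`, which is `J_{A⁻¹} (T^n x)`. Since
`⟪v_R, ·⟫` is bounded below on `R`, `v_R` is a lineality direction of the closure of `D`
(`add_smul_mem_closure_setD`); dually, `v_D` is one for the closure of `R`. Hence `v_D ⟂ v_R`, and
`v_D + v_R` lies in both closures. The range hypothesis then makes it the minimal displacement
vector of `T`, and Pazy's theorem gives `(a n + u n) / n → -(v_D + v_R)`.

To split this limit, note that `v_D` separates `dom A` from `dom B`, so `⟪v_D, a n⟫` is bounded; by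
duality so is `⟪v_R, u n⟫`. Monotonicity of `A` gives `⟪a n - a 0, u n - u 0⟫ ≥ 0`, and
`tendsto_of_add_of_inner_nonneg` concludes.

Attouch–Théra duality, replacing `(A, B)` by `(inv A, negInv B)`, preserves `T` and exchanges `D`
with `R`, so each fact is proved for one side only. -/

set_option linter.unusedSectionVars false

namespace DouglasRachford

/-! ### Maximal monotonicity and Attouch–Théra duality -/

section Monotone

variable {X : Type*} [NormedAddCommGroup X] [InnerProductSpace ℝ X] {A B : X → Set X}

/-- Adjoining the pair `(p, w)` to the graph keeps it monotone, so maximality forces the pair to be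
there already. -/
lemma IsMaximallyMonotone.mem_of_forall (hA : IsMaximallyMonotone A) {p w : X}
    (h : ∀ a, ∀ u ∈ A a, 0 ≤ inner ℝ (p - a) (w - u)) : w ∈ A p := by
  have key := hA.2 (fun x => {y | y ∈ A x ∨ (x = p ∧ y = w)}) ?_ (fun x y hy => Or.inl hy)
  · have : w ∈ (fun x => {y | y ∈ A x ∨ (x = p ∧ y = w)}) p := Or.inr ⟨rfl, rfl⟩
    rwa [key] at this
  · rintro x y u (hu | ⟨rfl, rfl⟩) v (hv | ⟨rfl, rfl⟩)
    · exact hA.1 x y u hu v hv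
    · have := h x u hu
      rwa [← neg_sub x y, ← neg_sub u v, inner_neg_neg] at this
    · exact h y v hv
    · simp

lemma IsMaximallyMonotone.exists_mem (hA : IsMaximallyMonotone A) : ∃ a u, u ∈ A a := by
  by_contra! h
  exact h 0 0 (hA.mem_of_forall fun a u hu => absurd hu (h a u))

lemma IsMonotone.inv (hA : IsMonotone A) : IsMonotone (inv A) := fun x y u hu v hv => by
  rw [real_inner_comm]; exact hA u v x hu y hv

lemma IsMaximallyMonotone.inv (hA : IsMaximallyMonotone A) : IsMaximallyMonotone (inv A) := by
  refine ⟨hA.1.inv, fun A' hA' hsub => ?_⟩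
  rw [← hA.2 (DouglasRachford.inv A') hA'.inv fun x u hu => hsub u hu]
  rfl

/-- The operator `(-Id) ∘ B⁻¹ ∘ (-Id)` of Attouch–Théra duality. -/
def negInv (B : X → Set X) : X → Set X := fun x => {y | -x ∈ B (-y)}

lemma IsMonotone.negInv (hB : IsMonotone B) : IsMonotone (negInv B) := fun x y u hu v hv => by
  have := hB _ _ _ hu _ hv
  rwa [← neg_add', ← neg_add', inner_neg_neg, real_inner_comm, ← sub_eq_add_neg,
    ← sub_eq_add_neg] at this

lemma negInv_negInv (B : X → Set X) : negInv (negInv B) = B := by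
  ext x y; simp [DouglasRachford.negInv]

lemma IsMaximallyMonotone.negInv (hB : IsMaximallyMonotone B) :
    IsMaximallyMonotone (negInv B) := by
  refine ⟨hB.1.negInv, fun B' hB' hsub => ?_⟩
  rw [← hB.2 (DouglasRachford.negInv B') hB'.negInv fun x u hu =>
    hsub (-u) (by simpa [DouglasRachford.negInv] using hu), negInv_negInv]

lemma setD_inv_negInv (A B : X → Set X) : setD (inv A) (negInv B) = setR A B := by
  ext z
  simp only [setD, setR, dom, ran, inv, negInv, Set.mem_ofPred_eq, Set.mem_iUnion, Set.Nonempty]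
  constructor
  · rintro ⟨a, ⟨x, hx⟩, b, ⟨y, hy⟩, rfl⟩
    exact ⟨a, ⟨x, hx⟩, -b, ⟨-y, hy⟩, sub_eq_add_neg a b⟩
  · rintro ⟨a, ⟨x, hx⟩, b, ⟨y, hy⟩, rfl⟩
    exact ⟨a, ⟨x, hx⟩, -b, ⟨-y, by simpa using hy⟩, (sub_neg_eq_add a b).symm⟩

lemma setR_inv_negInv (A B : X → Set X) : setR (inv A) (negInv B) = setD A B := by
  rw [← setD_inv_negInv, negInv_negInv]; rfl

end Monotone

/-! ### Minty's surjectivity theorem -/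

section Minty

variable {X : Type*} [NormedAddCommGroup X] [InnerProductSpace ℝ X]

/-- Convex combinations of points `(a, u, ⟪a, u⟫)` of a monotone set lie above the duality
product. -/
lemma inner_le_of_mem_convexHull {S : Set (X × X)}
    (hS : ∀ p ∈ S, ∀ q ∈ S, 0 ≤ inner ℝ (p.1 - q.1) (p.2 - q.2)) {z : (X × X) × ℝ}
    (hz : z ∈ convexHull ℝ ((fun p : X × X => (p, inner ℝ p.1 p.2)) '' S)) :
    inner ℝ z.1.1 z.1.2 ≤ z.2 := by
  have hconv : ∀ y : (X × X) × ℝ,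
      Convex ℝ {z : (X × X) × ℝ | inner ℝ z.1.1 y.1.2 + inner ℝ y.1.1 z.1.2 ≤ z.2 + y.2} := by
    intro y z hz z' hz' s t hs ht hst
    simp only [Set.mem_ofPred_eq, Prod.fst_add, Prod.smul_fst, Prod.snd_add, Prod.smul_snd,
      inner_add_left, inner_add_right, real_inner_smul_left, real_inner_smul_right,
      smul_eq_mul] at hz hz' ⊢
    have h1 := mul_le_mul_of_nonneg_left hz hs
    have h2 := mul_le_mul_of_nonneg_left hz' ht
    have h3 : y.2 = s * y.2 + t * y.2 := by rw [← add_mul, hst, one_mul]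
    linarith
  have h1 : ∀ q ∈ S, ∀ z ∈ convexHull ℝ ((fun p : X × X => (p, inner ℝ p.1 p.2)) '' S),
      inner ℝ z.1.1 q.2 + inner ℝ q.1 z.1.2 ≤ z.2 + inner ℝ q.1 q.2 := by
    intro q hq
    refine convexHull_min ?_ (hconv (q, inner ℝ q.1 q.2))
    rintro _ ⟨p, hp, rfl⟩
    have := hS p hp q hq
    simp only [inner_sub_left, inner_sub_right] at this
    change inner ℝ p.1 q.2 + inner ℝ q.1 p.2 ≤ inner ℝ p.1 p.2 + inner ℝ q.1 q.2
    linarith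
  have h2 : ∀ y ∈ convexHull ℝ ((fun p : X × X => (p, inner ℝ p.1 p.2)) '' S),
      inner ℝ y.1.1 z.1.2 + inner ℝ z.1.1 y.1.2 ≤ y.2 + z.2 := by
    refine convexHull_min ?_ (hconv z)
    rintro _ ⟨q, hq, rfl⟩
    have := h1 q hq z hz
    change inner ℝ q.1 z.1.2 + inner ℝ z.1.1 q.2 ≤ inner ℝ q.1 q.2 + z.2
    linarith
  linarith [h2 z hz]

/-- A concave quadratic `t - ‖w‖² / 4` bounded above by `0` on a convex set is, up to taking a
limit, maximized at a point satisfying the first-order condition. -/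
lemma exists_dual_point [CompleteSpace X] {K : Set (X × ℝ)} (hK : Convex ℝ K) (hne : K.Nonempty)
    (hle : ∀ z ∈ K, z.2 ≤ ‖z.1‖ ^ 2 / 4) :
    ∃ w : X, ∀ z ∈ K, z.2 + ‖w‖ ^ 2 / 4 - inner ℝ w z.1 / 2 ≤ 0 := by
  set d : X × ℝ → ℝ := fun z => z.2 - ‖z.1‖ ^ 2 / 4 with hd
  have hbdd : BddAbove (d '' K) := ⟨0, by
    rintro _ ⟨z, hz, rfl⟩; simp only [hd]; linarith [hle z hz]⟩
  set m := sSup (d '' K) with hm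
  have hm0 : m ≤ 0 := csSup_le (hne.image d) (by
    rintro _ ⟨z, hz, rfl⟩; simp only [hd]; linarith [hle z hz])
  have hdm : ∀ z ∈ K, d z ≤ m := fun z hz => le_csSup hbdd ⟨z, hz, rfl⟩
  obtain ⟨y, -, hy, hymem⟩ := exists_seq_tendsto_sSup (hne.image d) hbdd
  choose z hzK hzy using hymem
  -- By the parallelogram law, `d` at the midpoint exceeds the average of its values by `‖(z i).1 -
  -- (z j).1‖ ^ 2 / 16`, yet stays below `m`; so maximizing sequences are Cauchy in the first
  -- component.
  have hmid : ∀ i j, ‖(z i).1 - (z j).1‖ ^ 2 ≤ 8 * ((m - y i) + (m - y j)) := by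
    intro i j
    have h := hdm _ (hK (hzK i) (hzK j) (by norm_num : (0 : ℝ) ≤ 1 / 2)
      (by norm_num : (0 : ℝ) ≤ 1 / 2) (by norm_num))
    have hpar := parallelogram_law_with_norm ℝ (z i).1 (z j).1
    rw [← hzy i, ← hzy j]
    simp only [hd, Prod.fst_add, Prod.smul_fst, Prod.snd_add, Prod.smul_snd, smul_eq_mul,
      ← smul_add, norm_smul, mul_pow] at h ⊢
    norm_num at h
    nlinarith
  have hcau : CauchySeq fun i => (z i).1 := by
    rw [Metric.cauchySeq_iff]
    intro ε hε
    have hev : ∀ᶠ i in atTop, m - ε ^ 2 / 16 < y i :=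
      hy.eventually (lt_mem_nhds (by linarith [pow_pos hε 2]))
    obtain ⟨N, hN⟩ := eventually_atTop.1 hev
    refine ⟨N, fun i hi j hj => ?_⟩
    rw [dist_eq_norm]
    have h1 := hN i hi
    have h2 := hN j hj
    have h3 := hmid i j
    exact lt_of_pow_lt_pow_left₀ 2 hε.le (by linarith)
  obtain ⟨w, hw⟩ := cauchySeq_tendsto_of_complete hcau
  have ht : Tendsto (fun i => (z i).2) atTop (𝓝 (m + ‖w‖ ^ 2 / 4)) := by
    refine (hy.add ((hw.norm.pow 2).div_const 4)).congr fun i => ?_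
    rw [← hzy i]; simp [hd]
  refine ⟨w, fun q hq => le_trans ?_ hm0⟩
  -- First-order condition: `d ≤ m` on the segments from `z i` to `q`, in the limit over `i` and
  -- after division by `s`. `K` need not be closed, so the limit point itself may lie outside it.
  have hs : ∀ s : ℝ, 0 < s → s ≤ 1 →
      q.2 + ‖w‖ ^ 2 / 4 - inner ℝ w q.1 / 2 - m ≤ s * (‖q.1 - w‖ ^ 2 / 4) := by
    intro s hs0 hs1
    have h1 : ∀ i, (1 - s) * (z i).2 + s * q.2 - ‖(1 - s) • (z i).1 + s • q.1‖ ^ 2 / 4 ≤ m :=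
      fun i => hdm _ (hK (hzK i) hq (by linarith) hs0.le (by ring))
    have h2 := le_of_tendsto' (((ht.const_mul (1 - s)).add_const (s * q.2)).sub
      (((((hw.const_smul (1 - s)).add_const (s • q.1)).norm).pow 2).div_const 4)) h1
    have e1 : ‖(1 - s) • w + s • q.1‖ ^ 2 =
        ‖w‖ ^ 2 + 2 * s * (inner ℝ w q.1 - ‖w‖ ^ 2) + s ^ 2 * ‖q.1 - w‖ ^ 2 := by
      have : (1 - s) • w + s • q.1 = w + s • (q.1 - w) := by module
      rw [this, norm_add_sq_real, norm_smul, mul_pow, real_inner_smul_right, inner_sub_right,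
        real_inner_self_eq_norm_sq, Real.norm_eq_abs, sq_abs]
      ring
    rw [e1] at h2
    refine le_of_mul_le_mul_left ?_ hs0
    nlinarith
  have hlim : Tendsto (fun s : ℝ => s * (‖q.1 - w‖ ^ 2 / 4)) (𝓝[>] 0) (𝓝 0) := by
    have : Tendsto (fun s : ℝ => s * (‖q.1 - w‖ ^ 2 / 4)) (𝓝 0) (𝓝 (0 * (‖q.1 - w‖ ^ 2 / 4))) :=
      tendsto_id.mul_const _
    rw [zero_mul] at this
    exact this.mono_left nhdsWithin_le_nhds
  have := ge_of_tendsto hlim (by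
    filter_upwards [Ioc_mem_nhdsGT (zero_lt_one' ℝ)] with s hs' using hs s hs'.1 hs'.2)
  linarith

/-- The core of Minty's theorem: for a maximally monotone graph `S`, the pair `(p, -p)` belongs to
`S`, so `0` is in the range of `Id` plus the operator. The bound needed by `exists_dual_point` is
`-⟪x, u⟫ ≤ ‖u - x‖ ^ 2 / 4`, that is, `‖u + x‖ ^ 2 ≥ 0`. -/
lemma exists_monotonically_related [CompleteSpace X] {S : Set (X × X)} (hne : S.Nonempty)
    (hS : ∀ p ∈ S, ∀ q ∈ S, 0 ≤ inner ℝ (p.1 - q.1) (p.2 - q.2)) :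
    ∃ p : X, ∀ q ∈ S, 0 ≤ inner ℝ (p - q.1) (-p - q.2) := by
  set C := convexHull ℝ ((fun p : X × X => (p, inner ℝ p.1 p.2)) '' S) with hC
  let f : (X × X) × ℝ →ₗ[ℝ] X × ℝ :=
    ((LinearMap.snd ℝ X X - LinearMap.fst ℝ X X) ∘ₗ LinearMap.fst ℝ (X × X) ℝ).prod
      (-LinearMap.snd ℝ (X × X) ℝ)
  have hf : ∀ z, f z = (z.1.2 - z.1.1, -z.2) := fun z => rfl
  obtain ⟨w, hw⟩ := exists_dual_point (K := f '' C) ((convex_convexHull ℝ _).linear_image f)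
    (((hne.image _).convexHull).image _) (by
      rintro _ ⟨z, hz, rfl⟩
      have h1 := inner_le_of_mem_convexHull hS hz
      have h2 := norm_sub_sq_real z.1.2 z.1.1
      have h3 := norm_add_sq_real z.1.2 z.1.1
      have h4 := sq_nonneg ‖z.1.2 + z.1.1‖
      rw [real_inner_comm] at h1
      simp only [hf]
      linarith)
  refine ⟨-(1 / 2 : ℝ) • w, fun q hq => ?_⟩
  have h := hw _ ⟨_, subset_convexHull ℝ _ ⟨q, hq, rfl⟩, rfl⟩
  simp only [hf, inner_sub_right] at h
  simp only [inner_sub_left, inner_sub_right, inner_neg_right, real_inner_smul_left,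
    real_inner_smul_right]
  rw [real_inner_comm w q.1, real_inner_self_eq_norm_sq]
  linarith

variable {A B : X → Set X} [CompleteSpace X]

/-- Minty's theorem. -/
lemma IsMaximallyMonotone.exists_resolvent (hA : IsMaximallyMonotone A) {c : ℝ} (hc : 0 < c)
    (z : X) : ∃ p u, u ∈ A p ∧ z = p + c • u := by
  obtain ⟨a, u, hu⟩ := hA.exists_mem
  obtain ⟨p, hp⟩ := exists_monotonically_related
    (S := {q : X × X | ∃ u ∈ A q.1, q.2 = c • u - z}) ⟨(a, c • u - z), u, hu, rfl⟩ (by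
      rintro ⟨a, _⟩ ⟨u, hu, rfl⟩ ⟨b, _⟩ ⟨v, hv, rfl⟩
      have := hA.1 a b u hu v hv
      simp only [sub_sub_sub_cancel_right, ← smul_sub, real_inner_smul_right]
      positivity)
  refine ⟨p, c⁻¹ • (z - p), hA.mem_of_forall fun a u hu => ?_, ?_⟩
  · have h := hp (a, c • u - z) ⟨u, hu, rfl⟩
    have e : -p - (c • u - z) = c • (c⁻¹ • (z - p) - u) := by
      rw [smul_sub, smul_inv_smul₀ hc.ne']; abel
    rw [e, real_inner_smul_right] at h
    exact nonneg_of_mul_nonneg_right h hc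
  · rw [smul_inv_smul₀ hc.ne']; abel

end Minty

/-! ### Resolvents and the Douglas–Rachford operator -/

section Resolvent

variable {X : Type*} [NormedAddCommGroup X] [InnerProductSpace ℝ X] [CompleteSpace X]
  {A B : X → Set X}

lemma IsMaximallyMonotone.sub_resolvent_mem (hA : IsMaximallyMonotone A) (x : X) :
    x - resolvent A x ∈ A (resolvent A x) := by
  have : ∃ p, p ∈ DouglasRachford.inv (idAdd A) x := by
    obtain ⟨p, u, hu, h⟩ := hA.exists_resolvent one_pos x
    exact ⟨p, u, hu, by simpa using h⟩
  obtain ⟨u, hu, h⟩ := Classical.epsilon_spec this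
  change u ∈ A (resolvent A x) at hu
  change x = resolvent A x + u at h
  rwa [← eq_sub_of_add_eq' h.symm]

lemma IsMonotone.eq_of_sub_mem {A : X → Set X} (hA : IsMonotone A) {x p q : X}
    (hp : x - p ∈ A p) (hq : x - q ∈ A q) : p = q := by
  have := hA _ _ _ hp _ hq
  rw [sub_sub_sub_cancel_left, ← neg_sub p q, inner_neg_right, real_inner_self_eq_norm_sq] at this
  have h0 : ‖p - q‖ = 0 := by nlinarith [norm_nonneg (p - q)]
  exact sub_eq_zero.1 (norm_eq_zero.1 h0)

lemma IsMaximallyMonotone.resolvent_inv (hA : IsMaximallyMonotone A) (x : X) :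
    resolvent (DouglasRachford.inv A) x = x - resolvent A x := by
  have h1 : resolvent (DouglasRachford.inv A) x ∈ A (x - resolvent (DouglasRachford.inv A) x) :=
    hA.inv.sub_resolvent_mem x
  have h2 := hA.1.eq_of_sub_mem (hA.sub_resolvent_mem x) (by rwa [sub_sub_cancel])
  rw [h2, sub_sub_cancel]

lemma IsMaximallyMonotone.resolvent_negInv (hB : IsMaximallyMonotone B) (x : X) :
    resolvent (DouglasRachford.negInv B) x = x + resolvent B (-x) := by
  have h1 : -resolvent (DouglasRachford.negInv B) x ∈
      B (-(x - resolvent (DouglasRachford.negInv B) x)) := hB.negInv.sub_resolvent_mem x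
  have h2 := hB.1.eq_of_sub_mem (hB.sub_resolvent_mem (-x))
    (q := -(x - resolvent (DouglasRachford.negInv B) x)) (by convert h1 using 1; abel)
  rw [h2]; abel

lemma drOperator_inv_negInv (hA : IsMaximallyMonotone A) (hB : IsMaximallyMonotone B) (x : X) :
    drOperator (inv A) (negInv B) x = drOperator A B x := by
  have e : -reflected (inv A) x = reflected A x := by
    simp only [reflected, hA.resolvent_inv]; module
  rw [drOperator, hB.resolvent_negInv, e, neg_eq_iff_eq_neg.1 e, hA.resolvent_inv, drOperator]
  nth_rewrite 1 [reflected]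
  module

/-- The resolvent inclusion for `B` at `R_A x`, rewritten through the displacement `x - T x = J_A x
- J_B R_A x`. -/
lemma reflected_sub_mem (hB : IsMaximallyMonotone B) (x : X) :
    x - drOperator A B x - (x - resolvent A x) ∈
      B (resolvent A x - (x - drOperator A B x)) := by
  have h := hB.sub_resolvent_mem (reflected A x)
  have e1 : x - drOperator A B x - (x - resolvent A x) =
      reflected A x - resolvent B (reflected A x) := by
    simp only [drOperator]; nth_rewrite 2 [reflected]; module
  have e2 : resolvent A x - (x - drOperator A B x) = resolvent B (reflected A x) := by
    simp only [drOperator]; abel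
  rwa [e1, e2]

lemma sub_drOperator_mem (hA : IsMaximallyMonotone A) (hB : IsMaximallyMonotone B) (x : X) :
    x - drOperator A B x ∈ setD A B ∩ setR A B := by
  have h1 := hA.sub_resolvent_mem x
  have h2 := reflected_sub_mem (A := A) hB x
  exact ⟨⟨_, ⟨_, h1⟩, _, ⟨_, h2⟩, by abel⟩,
    ⟨_, Set.mem_iUnion.2 ⟨_, h1⟩, _, Set.mem_iUnion.2 ⟨_, h2⟩, by abel⟩⟩

lemma drOperator_nonexpansive (hA : IsMaximallyMonotone A) (hB : IsMaximallyMonotone B)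
    (x y : X) : ‖drOperator A B x - drOperator A B y‖ ≤ ‖x - y‖ := by
  have h1 := hA.1 _ _ _ (hA.sub_resolvent_mem x) _ (hA.sub_resolvent_mem y)
  have h2 := hB.1 _ _ _ (hB.sub_resolvent_mem (reflected A x)) _
    (hB.sub_resolvent_mem (reflected A y))
  have e1 : x - resolvent A x - (y - resolvent A y) = (x - y) - (resolvent A x - resolvent A y) := by
    abel
  have e2 : reflected A x - resolvent B (reflected A x) -
      (reflected A y - resolvent B (reflected A y)) =
      (2 : ℝ) • (resolvent A x - resolvent A y) - (x - y) -
        (resolvent B (reflected A x) - resolvent B (reflected A y)) := by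
    nth_rewrite 1 [reflected]
    nth_rewrite 2 [reflected]
    module
  have e3 : drOperator A B x - drOperator A B y = (x - y) - (resolvent A x - resolvent A y) +
      (resolvent B (reflected A x) - resolvent B (reflected A y)) := by
    simp only [drOperator]; abel
  rw [e1] at h1
  rw [e2] at h2
  rw [e3]
  generalize resolvent A x - resolvent A y = a at *
  generalize resolvent B (reflected A x) - resolvent B (reflected A y) = b at *
  generalize x - y = z at *
  refine le_of_sq_le_sq ?_ (norm_nonneg _)
  -- The identity used is `‖z‖ ^ 2 - ‖z - a + b‖ ^ 2 = 2⟪a, z - a⟫ + 2⟪b, 2a - z - b⟫ + ‖a - b‖ ^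
  -- 2`.
  have h3 := sq_nonneg ‖a - b‖
  simp only [← real_inner_self_eq_norm_sq, inner_add_left, inner_add_right, inner_sub_left,
    inner_sub_right, real_inner_smul_right] at *
  rw [real_inner_comm a b, real_inner_comm a z, real_inner_comm b z] at *
  linarith

end Resolvent

/-! ### Convexity and lineality of the closures of `D` and `R` -/

section Range

variable {X : Type*} [NormedAddCommGroup X] [InnerProductSpace ℝ X] [CompleteSpace X]
  {A B : X → Set X}

/-- Points whose resolvents `p = z - c u` satisfy a uniform quadratic estimate lie in the closure
of the domain. -/
lemma IsMaximallyMonotone.mem_closure_dom (hA : IsMaximallyMonotone A) {z : X} {M N : ℝ}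
    (h : ∀ c : ℝ, 0 < c → ∀ p, ∀ u ∈ A p, z = p + c • u →
      ‖z - p‖ ^ 2 ≤ c * (M + N * ‖z - p‖)) : z ∈ closure (dom A) := by
  choose! p u hu hz using fun (c : ℝ) (hc : 0 < c) => hA.exists_resolvent hc z
  -- Young's inequality absorbs the linear term `c * N * ‖z - p c‖` into the left-hand side.
  have hsmall : ∀ c : ℝ, 0 < c → c ≤ 1 → ‖z - p c‖ ^ 2 ≤ c * (2 * |M| + N ^ 2) := by
    intro c hc hc1
    have h1 := h c hc _ _ (hu c hc) (hz c hc)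
    have h2 := le_abs_self M
    have h3 := two_mul_le_add_sq ‖z - p c‖ (c * N)
    have h4 : (c * N) ^ 2 ≤ c * N ^ 2 := by nlinarith [sq_nonneg N, mul_nonneg hc.le (sq_nonneg N)]
    nlinarith
  have hlim : Tendsto (fun c : ℝ => c * (2 * |M| + N ^ 2)) (𝓝[>] 0) (𝓝 0) := by
    have : Tendsto (fun c : ℝ => c * (2 * |M| + N ^ 2)) (𝓝 0) (𝓝 (0 * (2 * |M| + N ^ 2))) :=
      tendsto_id.mul_const _
    rw [zero_mul] at this
    exact this.mono_left nhdsWithin_le_nhds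
  have hsq : Tendsto (fun c => ‖z - p c‖ ^ 2) (𝓝[>] 0) (𝓝 0) := by
    refine tendsto_of_tendsto_of_tendsto_of_le_of_le' tendsto_const_nhds hlim
      (Eventually.of_forall fun c => sq_nonneg _) ?_
    filter_upwards [Ioc_mem_nhdsGT (zero_lt_one' ℝ)] with c hc using hsmall c hc.1 hc.2
  have hp : Tendsto p (𝓝[>] 0) (𝓝 z) := by
    rw [tendsto_iff_norm_sub_tendsto_zero]
    have := hsq.sqrt
    simpa [Real.sqrt_sq, norm_sub_rev] using this
  exact mem_closure_of_tendsto hp (by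
    filter_upwards [self_mem_nhdsWithin] with c hc using ⟨u c, hu c hc⟩)

lemma IsMaximallyMonotone.convex_closure_dom (hA : IsMaximallyMonotone A) :
    Convex ℝ (closure (dom A)) := by
  intro a ha b hb s t hs ht hst
  have hcont : Continuous (Function.uncurry fun a b : X => s • a + t • b) := by
    simp only [Function.uncurry_def]; fun_prop
  rw [← closure_closure]
  refine map_mem_closure₂ (f := fun a b : X => s • a + t • b) hcont ha hb ?_
  rintro a ⟨u, hu⟩ b ⟨v, hv⟩
  set z := s • a + t • b with hz
  -- Monotonicity replaces `w` by `u` against `a - p` and by `v` against `b - p`; writing `a - p =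
  -- (a - z) + (z - p)`, and likewise for `b`, yields these constants.
  refine hA.mem_closure_dom (M := s * inner ℝ (a - z) u + t * inner ℝ (b - z) v)
    (N := ‖s • u + t • v‖) fun c hc p w hw hzp => ?_
  have h1 := mul_nonneg (mul_nonneg hc.le hs) (hA.1 p a w hw u hu)
  have h2 := mul_nonneg (mul_nonneg hc.le ht) (hA.1 p b w hw v hv)
  have h3 := real_inner_le_norm (z - p) (s • u + t • v)
  have h4 := mul_le_mul_of_nonneg_left h3 hc.le
  have ew : z - p = c • w := by rw [hzp]; abel
  have e : ‖z - p‖ ^ 2 = c * s * inner ℝ (a - p) w + c * t * inner ℝ (b - p) w := by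
    rw [← real_inner_self_eq_norm_sq]
    nth_rewrite 2 [ew]
    have : z - p = s • (a - p) + t • (b - p) := by
      rw [hz, smul_sub, smul_sub]
      nth_rewrite 1 [← one_smul ℝ p]
      rw [← hst]; module
    rw [this, real_inner_smul_right, inner_add_left, real_inner_smul_left, real_inner_smul_left]
    ring
  simp only [inner_sub_left, inner_sub_right, inner_add_right, real_inner_smul_right] at *
  nlinarith

/-- A direction along which the range is bounded above is a recession direction of the closure
of the domain. -/
lemma IsMaximallyMonotone.add_smul_mem_closure_dom (hA : IsMaximallyMonotone A) {w : X} {k : ℝ}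
    (hw : ∀ u ∈ ran A, inner ℝ w u ≤ k) {a : X} (ha : a ∈ dom A) {t : ℝ} (ht : 0 ≤ t) :
    a + t • w ∈ closure (dom A) := by
  obtain ⟨u, hu⟩ := ha
  refine hA.mem_closure_dom (M := t * (k - inner ℝ w u)) (N := ‖u‖) fun c hc p q hq hzp => ?_
  have h1 := mul_nonneg hc.le (hA.1 p a q hq u hu)
  have h2 := mul_le_mul_of_nonneg_left (hw q (Set.mem_iUnion.2 ⟨p, hq⟩)) (mul_nonneg hc.le ht)
  have h3 := mul_le_mul_of_nonneg_left (real_inner_le_norm (a + t • w - p) u) hc.le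
  have ew : a + t • w - p = c • q := by rw [hzp]; abel
  have e : p - a = t • w - (a + t • w - p) := by abel
  have e2 : ‖a + t • w - p‖ ^ 2 = c * inner ℝ (a + t • w - p) q := by
    rw [← real_inner_self_eq_norm_sq]
    nth_rewrite 2 [ew]
    rw [real_inner_smul_right]
  rw [e] at h1
  generalize a + t • w - p = y at *
  simp only [inner_sub_left, inner_sub_right, real_inner_smul_left] at *
  nlinarith

lemma closure_dom_sub_mem {a b : X} (ha : a ∈ closure (dom A)) (hb : b ∈ closure (dom B)) :
    a - b ∈ closure (setD A B) :=
  map_mem_closure₂ continuous_sub ha hb fun a ha b hb => ⟨a, ha, b, hb, rfl⟩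

lemma convex_closure_setD (hA : IsMaximallyMonotone A) (hB : IsMaximallyMonotone B) :
    Convex ℝ (closure (setD A B)) := by
  intro x hx y hy s t hs ht hst
  have hcont : Continuous (Function.uncurry fun a b : X => s • a + t • b) := by
    simp only [Function.uncurry_def]; fun_prop
  rw [← closure_closure]
  refine map_mem_closure₂ (f := fun a b : X => s • a + t • b) hcont hx hy ?_
  rintro _ ⟨a, ha, b, hb, rfl⟩ _ ⟨a', ha', b', hb', rfl⟩
  have := closure_dom_sub_mem
    (hA.convex_closure_dom (subset_closure ha) (subset_closure ha') hs ht hst)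
    (hB.convex_closure_dom (subset_closure hb) (subset_closure hb') hs ht hst)
  convert this using 1
  module

lemma setD_nonempty (hA : IsMaximallyMonotone A) (hB : IsMaximallyMonotone B) :
    (setD A B).Nonempty :=
  ⟨_, (sub_drOperator_mem hA hB 0).1⟩

lemma proj_zero_spec {C : Set X} (hne : C.Nonempty) (hcl : IsClosed C) (hC : Convex ℝ C) :
    proj C 0 ∈ C ∧ ∀ z ∈ C, ‖proj C 0‖ ^ 2 ≤ inner ℝ (proj C 0) z := by
  have hex : ∃ p, p ∈ C ∧ ∀ c ∈ C, ‖(0 : X) - p‖ ≤ ‖0 - c‖ := by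
    obtain ⟨p, hp, h⟩ := exists_norm_eq_iInf_of_complete_convex hne hcl.isComplete hC (0 : X)
    refine ⟨p, hp, fun c hc => h.trans_le ?_⟩
    exact ciInf_le (f := fun w : C => ‖(0 : X) - w‖)
      ⟨0, by rintro _ ⟨w, rfl⟩; exact norm_nonneg _⟩ ⟨c, hc⟩
  obtain ⟨hp, hmin⟩ : proj C 0 ∈ C ∧ ∀ c ∈ C, ‖(0 : X) - proj C 0‖ ≤ ‖0 - c‖ :=
    Classical.epsilon_spec hex
  refine ⟨hp, fun z hz => ?_⟩
  have heq : ‖(0 : X) - proj C 0‖ = ⨅ w : C, ‖(0 : X) - w‖ := by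
    have : Nonempty C := hne.to_subtype
    exact le_antisymm (le_ciInf fun w => hmin w w.2)
      (ciInf_le (f := fun w : C => ‖(0 : X) - w‖)
        ⟨0, by rintro _ ⟨w, rfl⟩; exact norm_nonneg _⟩ ⟨_, hp⟩)
  have := (norm_eq_iInf_iff_real_inner_le_zero hC hp).1 heq z hz
  rw [zero_sub, inner_neg_left, inner_sub_right, real_inner_self_eq_norm_sq] at this
  linarith

lemma vD_spec (hA : IsMaximallyMonotone A) (hB : IsMaximallyMonotone B) :
    vD A B ∈ closure (setD A B) ∧ ∀ z ∈ closure (setD A B), ‖vD A B‖ ^ 2 ≤ inner ℝ (vD A B) z :=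
  proj_zero_spec (setD_nonempty hA hB).closure isClosed_closure (convex_closure_setD hA hB)

lemma vD_inv_negInv (A B : X → Set X) : vD (inv A) (negInv B) = vR A B := by
  rw [vD, vR, setD_inv_negInv]

lemma vR_spec (hA : IsMaximallyMonotone A) (hB : IsMaximallyMonotone B) :
    vR A B ∈ closure (setR A B) ∧ ∀ z ∈ closure (setR A B), ‖vR A B‖ ^ 2 ≤ inner ℝ (vR A B) z := by
  have := vD_spec hA.inv hB.negInv
  rwa [vD_inv_negInv, setD_inv_negInv] at this

/-- A direction along which `ran A + ran B` is bounded below is a lineality direction of the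
closure of `dom A - dom B`. -/
lemma add_smul_mem_closure_setD (hA : IsMaximallyMonotone A) (hB : IsMaximallyMonotone B) {w : X}
    {k : ℝ} (hw : ∀ r ∈ setR A B, k ≤ inner ℝ w r) {z : X} (hz : z ∈ closure (setD A B)) (t : ℝ) :
    z + t • w ∈ closure (setD A B) := by
  rw [← closure_closure]
  refine map_mem_closure (f := fun z => z + t • w) (by fun_prop) hz ?_
  rintro _ ⟨a, ha, b, hb, rfl⟩
  obtain ⟨u, hu⟩ := ha
  obtain ⟨v, hv⟩ := hb
  -- Fixing one summand of `setR A B` bounds the other range above along `-w`. For `t ≥ 0` the point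
  -- of `dom B` moves, for `t ≤ 0` that of `dom A`.
  rcases le_total 0 t with ht | ht
  · have h : b + t • (-w) ∈ closure (dom B) :=
      hB.add_smul_mem_closure_dom (k := inner ℝ w u - k) (fun s hs => by
        have := hw _ ⟨u, Set.mem_iUnion.2 ⟨a, hu⟩, s, hs, rfl⟩
        rw [inner_add_right] at this
        rw [inner_neg_left]; linarith) ⟨v, hv⟩ ht
    convert closure_dom_sub_mem (subset_closure (⟨u, hu⟩ : a ∈ dom A)) h using 1
    module
  · have h : a + (-t) • (-w) ∈ closure (dom A) :=
      hA.add_smul_mem_closure_dom (k := inner ℝ w v - k) (fun s hs => by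
        have := hw _ ⟨s, hs, v, Set.mem_iUnion.2 ⟨b, hv⟩, rfl⟩
        rw [inner_add_right] at this
        rw [inner_neg_left]; linarith) ⟨u, hu⟩ (neg_nonneg.2 ht)
    convert closure_dom_sub_mem h (subset_closure (⟨v, hv⟩ : b ∈ dom B)) using 1
    module

lemma add_smul_vR_mem (hA : IsMaximallyMonotone A) (hB : IsMaximallyMonotone B) {z : X}
    (hz : z ∈ closure (setD A B)) (t : ℝ) : z + t • vR A B ∈ closure (setD A B) :=
  add_smul_mem_closure_setD hA hB (fun r hr => (vR_spec hA hB).2 r (subset_closure hr)) hz t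

lemma add_smul_vD_mem (hA : IsMaximallyMonotone A) (hB : IsMaximallyMonotone B) {z : X}
    (hz : z ∈ closure (setR A B)) (t : ℝ) : z + t • vD A B ∈ closure (setR A B) := by
  rw [← setD_inv_negInv] at hz ⊢
  refine add_smul_mem_closure_setD hA.inv hB.negInv (k := ‖vD A B‖ ^ 2) (fun r hr => ?_) hz t
  rw [setR_inv_negInv] at hr
  exact (vD_spec hA hB).2 r (subset_closure hr)

/-- The whole line `vD + t • vR` stays in the closure of `D`, and minimality of `vD` on it, for both
signs of `t`, forces orthogonality. -/
lemma inner_vD_vR (hA : IsMaximallyMonotone A) (hB : IsMaximallyMonotone B) :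
    inner ℝ (vD A B) (vR A B) = (0 : ℝ) := by
  have h : ∀ t : ℝ, 0 ≤ t * inner ℝ (vD A B) (vR A B) := fun t => by
    have := (vD_spec hA hB).2 _ (add_smul_vR_mem hA hB (vD_spec hA hB).1 t)
    rw [inner_add_right, real_inner_self_eq_norm_sq, real_inner_smul_right] at this
    linarith
  linarith [h 1, h (-1)]

lemma vD_add_vR_mem (hA : IsMaximallyMonotone A) (hB : IsMaximallyMonotone B) :
    vD A B + vR A B ∈ closure (setD A B) ∩ closure (setR A B) := by
  refine ⟨?_, ?_⟩
  · simpa using add_smul_vR_mem hA hB (vD_spec hA hB).1 1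
  · simpa [add_comm] using add_smul_vD_mem hA hB (vR_spec hA hB).1 1

end Range

/-! ### Pazy's theorem and asymptotics of the two components -/

section Asymptotics

variable {X : Type*} [NormedAddCommGroup X] [InnerProductSpace ℝ X]

lemma tendsto_one_div_smul_const (a : X) :
    Tendsto (fun n : ℕ => (1 / (n : ℝ)) • a) atTop (𝓝 0) := by
  simpa using (tendsto_one_div_atTop_nhds_zero_nat (𝕜 := ℝ)).smul_const a

lemma tendsto_one_div_mul_of_bounded {f : ℕ → ℝ} {M : ℝ} (hf : ∀ n, |f n| ≤ M) :
    Tendsto (fun n : ℕ => (1 / (n : ℝ)) * f n) atTop (𝓝 0) :=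
  (tendsto_one_div_atTop_nhds_zero_nat (𝕜 := ℝ)).zero_mul_isBoundedUnder_le
    (isBoundedUnder_of ⟨M, fun n => by simpa using hf n⟩)

lemma norm_iterate_sub_le {T : X → X} (hT : ∀ x y, ‖T x - T y‖ ≤ ‖x - y‖) (x y : X) (n : ℕ) :
    ‖T^[n] x - T^[n] y‖ ≤ ‖x - y‖ := by
  induction n with
  | zero => simp
  | succ n ih =>
    rw [Function.iterate_succ_apply', Function.iterate_succ_apply']
    exact (hT _ _).trans ih

/-- Pazy's theorem: the iterates of a nonexpansive map drift along minus its minimal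
displacement vector. -/
lemma tendsto_iterate_div {T : X → X} (hT : ∀ x y, ‖T x - T y‖ ≤ ‖x - y‖) {v : X}
    (hv : v ∈ closure (Set.range fun x => x - T x))
    (hmin : ∀ x, ‖v‖ ^ 2 ≤ inner ℝ v (x - T x)) (x : X) :
    Tendsto (fun n : ℕ => (1 / (n : ℝ)) • (T^[n] x - x)) atTop (𝓝 (-v)) := by
  rw [Metric.tendsto_atTop]
  intro ε hε
  obtain ⟨δ, hδ, hδε⟩ : ∃ δ : ℝ, 0 < δ ∧ (‖v‖ + δ) ^ 2 - ‖v‖ ^ 2 < (ε / 2) ^ 2 := by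
    have hc : Tendsto (fun δ : ℝ => (‖v‖ + δ) ^ 2 - ‖v‖ ^ 2) (𝓝[>] 0) (𝓝 0) := by
      have : Continuous fun δ : ℝ => (‖v‖ + δ) ^ 2 - ‖v‖ ^ 2 := by fun_prop
      simpa using (this.tendsto 0).mono_left nhdsWithin_le_nhds
    obtain ⟨δ, h1, h2⟩ := ((hc.eventually (gt_mem_nhds (by positivity : 0 < (ε / 2) ^ 2))).and
      self_mem_nhdsWithin).exists
    exact ⟨δ, h2, h1⟩
  obtain ⟨_, ⟨y, rfl⟩, hy⟩ := Metric.mem_closure_iff.1 hv δ hδ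
  have hyn : ‖y - T y‖ ≤ ‖v‖ + δ := by
    rw [dist_eq_norm, norm_sub_rev] at hy
    have := norm_add_le v (y - T y - v)
    rw [add_sub_cancel] at this
    linarith
  -- Every displacement `d` along the orbit of `y` has norm at most `‖v‖ + δ`, and `⟪v, d⟫ ≥ ‖v‖ ^
  -- 2` gives `‖v - d‖ ^ 2 ≤ ‖d‖ ^ 2 - ‖v‖ ^ 2`.
  have hstep : ∀ n, ‖T^[n + 1] y - T^[n] y + v‖ ≤ ε / 2 := by
    intro n
    have h1 : ‖T^[n] y - T^[n + 1] y‖ ≤ ‖y - T y‖ := by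
      rw [Function.iterate_succ_apply]; exact norm_iterate_sub_le hT _ _ n
    have h2 := hmin (T^[n] y)
    rw [← Function.iterate_succ_apply' T n y] at h2
    have h3 := norm_sub_sq_real v (T^[n] y - T^[n + 1] y)
    have e : T^[n + 1] y - T^[n] y + v = v - (T^[n] y - T^[n + 1] y) := by abel
    rw [e]
    refine le_of_sq_le_sq ?_ (by positivity)
    have h4 : ‖T^[n] y - T^[n + 1] y‖ ^ 2 ≤ (‖v‖ + δ) ^ 2 := by
      gcongr; exact h1.trans hyn
    linarith
  have hsum : ∀ n : ℕ, ‖T^[n] y - y + (n : ℝ) • v‖ ≤ n * (ε / 2) := by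
    intro n
    induction n with
    | zero => simp
    | succ n ih =>
      have e : T^[n + 1] y - y + ((n + 1 : ℕ) : ℝ) • v =
          (T^[n] y - y + (n : ℝ) • v) + (T^[n + 1] y - T^[n] y + v) := by
        push_cast; module
      rw [e]
      refine (norm_add_le _ _).trans ?_
      push_cast
      linarith [hstep n]
  obtain ⟨N, hN⟩ := exists_nat_gt (2 * (2 * ‖x - y‖) / ε)
  refine ⟨N + 1, fun n hn => ?_⟩
  have hn0 : (0 : ℝ) < n := by exact_mod_cast (by omega : 0 < n)
  have hNn : (N : ℝ) ≤ n := by exact_mod_cast (by omega : N ≤ n)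
  have hlt : 2 * ‖x - y‖ < n * (ε / 2) := by
    rw [div_lt_iff₀ hε] at hN
    nlinarith
  have e : (1 / (n : ℝ)) • (T^[n] x - x) - -v =
      (1 / (n : ℝ)) • ((T^[n] y - y + (n : ℝ) • v) + (T^[n] x - T^[n] y) - (x - y)) := by
    have : v = (1 / (n : ℝ)) • ((n : ℝ) • v) := by
      rw [smul_smul, one_div_mul_cancel hn0.ne', one_smul]
    nth_rewrite 1 [this]
    module
  rw [dist_eq_norm, e, norm_smul, Real.norm_of_nonneg (by positivity), one_div,
    inv_mul_lt_iff₀ hn0]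
  have h1 := norm_sub_le ((T^[n] y - y + (n : ℝ) • v) + (T^[n] x - T^[n] y)) (x - y)
  have h2 := norm_add_le (T^[n] y - y + (n : ℝ) • v) (T^[n] x - T^[n] y)
  linarith [hsum n, norm_iterate_sub_le hT x y n]

/-- Two sequences with nonnegative inner products whose sum converges to `p + q` with `p ⟂ q`, and
which are asymptotically orthogonal to `q` and `p` respectively, converge to `p` and `q`. -/
lemma tendsto_of_add_of_inner_nonneg {α β : ℕ → X} {p q : X} (hpq : inner ℝ p q = (0 : ℝ))
    (hsum : Tendsto (fun n => α n + β n) atTop (𝓝 (p + q))) (hnn : ∀ n, 0 ≤ inner ℝ (α n) (β n))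
    (hα : Tendsto (fun n => inner ℝ q (α n)) atTop (𝓝 (0 : ℝ)))
    (hβ : Tendsto (fun n => inner ℝ p (β n)) atTop (𝓝 (0 : ℝ))) :
    Tendsto α atTop (𝓝 p) ∧ Tendsto β atTop (𝓝 q) := by
  have hlim : Tendsto (fun n => ‖(α n + β n) - (p + q)‖ ^ 2 + 2 * inner ℝ q (α n) +
      2 * inner ℝ p (β n)) atTop (𝓝 0) := by
    have h := (hsum.sub_const (p + q)).norm.pow 2
    have := (h.add (hα.const_mul 2)).add (hβ.const_mul 2)
    simpa using this
  -- Expand the square of the sum; the cross term contributes `-2⟪α n, β n⟫ ≤ 0`, and `⟪p, q⟫`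
  -- vanishes.
  have hle : ∀ n, ‖α n - p‖ ^ 2 + ‖β n - q‖ ^ 2 ≤
      ‖(α n + β n) - (p + q)‖ ^ 2 + 2 * inner ℝ q (α n) + 2 * inner ℝ p (β n) := by
    intro n
    have e : (α n + β n) - (p + q) = (α n - p) + (β n - q) := by abel
    have := hnn n
    rw [e, norm_add_sq_real, inner_sub_left, inner_sub_right, inner_sub_right, hpq,
      real_inner_comm q (α n)]
    linarith
  have aux : ∀ (f : ℕ → X) (c : X), (∀ n, ‖f n - c‖ ^ 2 ≤
      ‖(α n + β n) - (p + q)‖ ^ 2 + 2 * inner ℝ q (α n) + 2 * inner ℝ p (β n)) →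
      Tendsto f atTop (𝓝 c) := by
    intro f c hf
    rw [tendsto_iff_norm_sub_tendsto_zero]
    have := (squeeze_zero (fun n => sq_nonneg _) hf hlim).sqrt
    simpa [Real.sqrt_sq] using this
  exact ⟨aux α p fun n => by linarith [hle n, sq_nonneg ‖β n - q‖],
    aux β q fun n => by linarith [hle n, sq_nonneg ‖α n - p‖]⟩

variable [CompleteSpace X] {A B : X → Set X}

/-- Along an orbit with bounded displacements, the resolvents stay bounded in the direction
`vD`. -/
lemma exists_abs_inner_vD_resolvent_le (hA : IsMaximallyMonotone A) (hB : IsMaximallyMonotone B)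
    {x : ℕ → X} {K : ℝ} (hx : ∀ n, ‖x n - drOperator A B (x n)‖ ≤ K) :
    ∃ M : ℝ, ∀ n, |inner ℝ (vD A B) (resolvent A (x n))| ≤ M := by
  obtain ⟨a, u, hu⟩ := hA.exists_mem
  obtain ⟨b, s, hs⟩ := hB.exists_mem
  have key : ∀ a ∈ dom A, ∀ b ∈ dom B, inner ℝ (vD A B) b ≤ inner ℝ (vD A B) a := by
    intro a ha b hb
    have := (vD_spec hA hB).2 _ (subset_closure ⟨a, ha, b, hb, rfl⟩)
    rw [inner_sub_right] at this
    linarith [sq_nonneg ‖vD A B‖]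
  refine ⟨|inner ℝ (vD A B) a| + |inner ℝ (vD A B) b| + ‖vD A B‖ * K, fun n => ?_⟩
  have h1 := key _ ⟨_, hA.sub_resolvent_mem (x n)⟩ b ⟨s, hs⟩
  -- The upper bound goes through `J_B R_A (x n) ∈ dom B`, which differs from `J_A (x n)` by the
  -- bounded displacement.
  have h2 := key a ⟨u, hu⟩ _ ⟨_, reflected_sub_mem (A := A) hB (x n)⟩
  rw [inner_sub_right] at h2
  have h3 := real_inner_le_norm (vD A B) (x n - drOperator A B (x n))
  have h4 := mul_le_mul_of_nonneg_left (hx n) (norm_nonneg (vD A B))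
  have h5 : 0 ≤ ‖vD A B‖ * K := le_trans (by positivity) h4
  rw [abs_le]
  constructor
  · linarith [neg_abs_le (inner ℝ (vD A B) b), abs_nonneg (inner ℝ (vD A B) a)]
  · linarith [le_abs_self (inner ℝ (vD A B) a), abs_nonneg (inner ℝ (vD A B) b)]

/-- Along an orbit with bounded displacements, the dual resolvents stay bounded in the direction
`vR`. -/
lemma exists_abs_inner_vR_sub_resolvent_le (hA : IsMaximallyMonotone A)
    (hB : IsMaximallyMonotone B) {x : ℕ → X} {K : ℝ}
    (hx : ∀ n, ‖x n - drOperator A B (x n)‖ ≤ K) :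
    ∃ M : ℝ, ∀ n, |inner ℝ (vR A B) (x n - resolvent A (x n))| ≤ M := by
  have := exists_abs_inner_vD_resolvent_le hA.inv hB.negInv (x := x) (K := K)
    (fun n => by rw [drOperator_inv_negInv hA hB]; exact hx n)
  simpa only [vD_inv_negInv, hA.resolvent_inv] using this

end Asymptotics

end DouglasRachford

/-! ### The main theorem -/

theorem mainTheorem9 {X : Type*} [NormedAddCommGroup X] [InnerProductSpace ℝ X] [CompleteSpace X]
    (A B : X → Set X)
    (hA : DouglasRachford.IsMaximallyMonotone A) (hB : DouglasRachford.IsMaximallyMonotone B)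
    (hran : closure (Set.range fun x => x - DouglasRachford.drOperator A B x) =
      closure (DouglasRachford.setD A B ∩ DouglasRachford.setR A B))
    (hDR : closure (DouglasRachford.setD A B ∩ DouglasRachford.setR A B) =
      closure (DouglasRachford.setD A B) ∩ closure (DouglasRachford.setR A B))
    (x : X) :
    Tendsto (fun n : ℕ => (1 / (n : ℝ)) •
        DouglasRachford.resolvent A ((DouglasRachford.drOperator A B)^[n] x))
      atTop (𝓝 (-DouglasRachford.vR A B)) ∧
    Tendsto (fun n : ℕ => (1 / (n : ℝ)) •
        DouglasRachford.resolvent (DouglasRachford.inv A)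
          ((DouglasRachford.drOperator A B)^[n] x))
      atTop (𝓝 (-DouglasRachford.vD A B)) := by
  open DouglasRachford in
  set T := drOperator A B with hTdef
  have hT : ∀ x y, ‖T x - T y‖ ≤ ‖x - y‖ := drOperator_nonexpansive hA hB
  have horth := inner_vD_vR hA hB
  have hpazy := tendsto_iterate_div hT (v := vD A B + vR A B)
    (by rw [hran, hDR]; exact vD_add_vR_mem hA hB) (fun y => by
      obtain ⟨h1, h2⟩ := sub_drOperator_mem hA hB y
      have h3 := (vD_spec hA hB).2 _ (subset_closure h1)
      have h4 := (vR_spec hA hB).2 _ (subset_closure h2)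
      rw [norm_add_sq_real, horth, inner_add_left]
      linarith) x
  have hK : ∀ n, ‖T^[n] x - T (T^[n] x)‖ ≤ ‖x - T x‖ := fun n => by
    rw [← Function.iterate_succ_apply' T n x, Function.iterate_succ_apply]
    exact norm_iterate_sub_le hT _ _ n
  obtain ⟨M, hM⟩ := exists_abs_inner_vD_resolvent_le hA hB hK
  obtain ⟨N, hN⟩ := exists_abs_inner_vR_sub_resolvent_le hA hB hK
  set a : ℕ → X := fun n => resolvent A (T^[n] x) with ha
  set u : ℕ → X := fun n => T^[n] x - a n with hu
  have hscal : ∀ (w : X) (f : ℕ → X) (M : ℝ), (∀ n, |inner ℝ w (f n)| ≤ M) →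
      Tendsto (fun n : ℕ => inner ℝ (-w) ((1 / (n : ℝ)) • (f n - f 0))) atTop (𝓝 (0 : ℝ)) := by
    intro w f M hf
    have := tendsto_one_div_mul_of_bounded (f := fun n => inner ℝ (-w) (f n - f 0)) (M := M + M)
      fun n => by
        rw [inner_neg_left, abs_neg, inner_sub_right]
        exact (abs_sub _ _).trans (add_le_add (hf n) (hf 0))
    simpa only [real_inner_smul_right] using this
  -- Subtracting the initial values makes monotonicity of `A` yield a nonnegative inner product; the
  -- subtracted terms vanish after division by `n`.
  have hmain := tendsto_of_add_of_inner_nonneg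
    (α := fun n : ℕ => (1 / (n : ℝ)) • (a n - a 0)) (β := fun n : ℕ => (1 / (n : ℝ)) • (u n - u 0))
    (p := -vR A B) (q := -vD A B) (by rw [inner_neg_neg, real_inner_comm, horth])
    (by
      rw [← neg_add, add_comm (vR A B)]
      refine hpazy.congr fun n => ?_
      rw [← smul_add]
      congr 1
      simp only [hu, Function.iterate_zero, id_eq]
      abel)
    (fun n => by
      have := hA.1 _ _ _ (hA.sub_resolvent_mem (T^[n] x)) _ (hA.sub_resolvent_mem (T^[0] x))
      rw [real_inner_smul_left, real_inner_smul_right]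
      have h : 0 ≤ inner ℝ (a n - a 0) (u n - u 0) := this
      positivity)
    (hscal (vD A B) a M hM) (hscal (vR A B) u N hN)
  constructor
  · have := hmain.1.add (tendsto_one_div_smul_const (a 0))
    simpa [← smul_add] using this
  · have := hmain.2.add (tendsto_one_div_smul_const (u 0))
    simpa [← smul_add, hA.resolvent_inv] using this
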